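/- Let $n\ge 1$, $1<p<\infty$ and $1/p+1/p'=1$. For $f\in L^1(\mathbb R^n)$ let $$\mathcal H f(x)=\frac1{\upsilon_n|x|^n}\int_{|y|<|x|}f(y)\,dy,\qquad x\ne 0,$$ where $\upsilon_n$ is the volume of the unit ball. For $k\in\mathbb Z$ let $\chi_k$ be the indicator function of $\{2^{k-1}<|x|\le 2^k\}$; the Herz space $K_p(\mathbb R^n)$ consists of the measurable $f$ with $\|f\|_{K_p}=\sum_{k\in\mathbb Z}2^{kn/p'}\|f\chi_k\|_p<\infty$. For an integer $N>n+1$ let $\mathcal A_N$ be the set of Schwartz functions $\varphi$ with $|x|^j\|D^m\varphi(x)\|\le1$ for all $x$ and all $0\le j,m\le N$, where $\|D^m\varphi(x)\|$ is the operator norm of the $m$-th derivative as a multilinear form. Let $\varphi_t(x)=t^{-n}\varphi(x/t)$ and $$G_Nf(x)=\sup_{\varphi\in\mathcal A_N}\ \sup_{t>0,\,|y-x|<t}|f*\varphi_t(y)|.$$ The Herz-type Hardy space $HK_p(\mathbb R^n)$ consists of the $f\in L^1(\mathbb R^n)$ with $\|f\|_{HK_p}=\|G_Nf\|_{K_p}<\infty$.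 Then $\mathcal H$ maps $HK_p(\mathbb R^n)$ boundedly into $K_p(\mathbb R^n)$: for every $N>n+1$ there is a constant $C=C(n,p,N)$ such that $\mathcal Hf\in K_p(\mathbb R^n)$ and $\|\mathcal Hf\|_{K_p}\le C\|f\|_{HK_p}$ for all $f\in HK_p(\mathbb R^n)$. The same holds for the atomic description of the space. A central $(1,p)$-atom is a measurable function $a$ for which there is $r>0$ such that $a$ vanishes outside the closed ball $\{|x|\le r\}$, $\|a\|_p\le|B(0,r)|^{1/p-1}$ and $\int a=0$. There is $C=C(n,p)$ such that every $f\in L^1(\mathbb R^n)$ that can be written as $f=\sum_{j}\lambda_ja_j$ almost everywhere, with central $(1,p)$-atoms $a_j$ and $\sum_j|\lambda_j|<\infty$, satisfies $\mathcal Hf\in K_p(\mathbb R^n)$ and $\|\mathcal Hf\|_{K_p}\le C\inf\sum_j|\lambda_j|$, the infimum being over all such decompositions. -/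

import Mathlib

open MeasureTheory Metric Set
open scoped ENNReal NNReal SchwartzMap

noncomputable section

namespace HerzHardy

/-- `ℝⁿ` with its Euclidean norm. -/
abbrev Rn (n : ℕ) : Type := EuclideanSpace ℝ (Fin n)

/-- The `n`-dimensional Hardy operator
`𝓗 f (x) = (υₙ |x|ⁿ)⁻¹ ∫_{|y| < |x|} f(y) dy`, where `υₙ` is the volume of the unit ball.
It is only used for integrable `f`, and the value at the single point `x = 0` is irrelevant. -/
def hardyOp {n : ℕ} (f : Rn n → ℂ) (x : Rn n) : ℂ :=
  ((volume.real (ball (0 : Rn n) 1) * ‖x‖ ^ n)⁻¹ : ℝ) • ∫ y in ball (0 : Rn n) ‖x‖, f y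

/-- The dyadic annulus `C_k = B_k \ B_{k-1}`, `B_k = {x : |x| ≤ 2 ^ k}`, for `k ∈ ℤ`. -/
def annulus (n : ℕ) (k : ℤ) : Set (Rn n) :=
  closedBall (0 : Rn n) ((2 : ℝ) ^ k) \ closedBall (0 : Rn n) ((2 : ℝ) ^ (k - 1))

/-- The Herz norm `‖f‖_{K_p} = ∑_{k ∈ ℤ} 2 ^ (k n / p') ‖f χ_k‖_p` as an element of `[0, ∞]`,
for functions with values in `ℂ` or in `[0, ∞]`. -/
def herzENorm {n : ℕ} {ε : Type*} [ENorm ε] [Zero ε] (p : ℝ) (f : Rn n → ε) : ℝ≥0∞ :=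
  ∑' k : ℤ, ENNReal.ofReal ((2 : ℝ) ^ ((k : ℝ) * (n : ℝ) / Real.conjExponent p)) *
    eLpNorm ((annulus n k).indicator f) (ENNReal.ofReal p) volume

/-- Membership in the Herz space `K_p(ℝⁿ)`. -/
def MemHerz {n : ℕ} (p : ℝ) (f : Rn n → ℂ) : Prop :=
  AEStronglyMeasurable f volume ∧ herzENorm p f < ∞

/-- The normalized class `𝓐_N` of Schwartz functions:
`|x| ^ j * ‖D^m φ(x)‖ ≤ 1` for all `x` and all `j, m ≤ N`. -/
def testClass (n N : ℕ) : Set 𝓢(Rn n, ℂ) :=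
  {φ | ∀ j ≤ N, ∀ m ≤ N, ∀ x : Rn n, ‖x‖ ^ j * ‖iteratedFDeriv ℝ m φ x‖ ≤ 1}

/-- `(f * φ_t)(y)`, where `φ_t(z) = t⁻ⁿ φ(z / t)`. -/
def dilConv {n : ℕ} (f : Rn n → ℂ) (φ : 𝓢(Rn n, ℂ)) (t : ℝ) (y : Rn n) : ℂ :=
  ∫ z, f z * (((t ^ n)⁻¹ : ℝ) • φ (t⁻¹ • (y - z)))

/-- The grand maximal function
`G_N f (x) = sup_{φ ∈ 𝓐_N} sup_{t > 0, |y - x| < t} |(f * φ_t)(y)|`, with values in `[0, ∞]`. -/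
def grandMaximal {n : ℕ} (N : ℕ) (f : Rn n → ℂ) (x : Rn n) : ℝ≥0∞ :=
  ⨆ φ ∈ testClass n N, ⨆ (t : ℝ) (y : Rn n) (_ : 0 < t ∧ ‖y - x‖ < t), ‖dilConv f φ t y‖ₑ

/-- The norm `‖f‖_{HK_p} = ‖G_N f‖_{K_p}` of the Herz-type Hardy space. -/
def hardyHerzENorm {n : ℕ} (N : ℕ) (p : ℝ) (f : Rn n → ℂ) : ℝ≥0∞ :=
  herzENorm p (grandMaximal N f)

/-- Membership in the Herz-type Hardy space `HK_p(ℝⁿ)`: `f ∈ L¹` and `G_N f ∈ K_p`. -/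
def MemHardyHerz {n : ℕ} (N : ℕ) (p : ℝ) (f : Rn n → ℂ) : Prop :=
  Integrable f volume ∧ hardyHerzENorm N p f < ∞

/-- Central `(1, p)`-atoms. -/
def IsCentralAtom {n : ℕ} (p : ℝ) (a : Rn n → ℂ) : Prop :=
  AEStronglyMeasurable a volume ∧
  ∃ r : ℝ, 0 < r ∧ Function.support a ⊆ closedBall (0 : Rn n) r ∧
    eLpNorm a (ENNReal.ofReal p) volume ≤ volume (ball (0 : Rn n) r) ^ (1 / p - 1) ∧
    ∫ x, a x = 0

/-- `f = ∑_j c_j a_j` (almost everywhere), with central `(1, p)`-atoms `a_j` and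
`∑_j |c_j| < ∞`. -/
def IsAtomicDecomposition {n : ℕ} (p : ℝ) (f : Rn n → ℂ) (c : ℕ → ℂ) (a : ℕ → Rn n → ℂ) : Prop :=
  (∀ j, IsCentralAtom p (a j)) ∧ Summable (fun j => ‖c j‖) ∧
    ∀ᵐ x : Rn n, HasSum (fun j => c j * a j x) (f x)

/-- The atomic norm of the Herz-type Hardy space: the infimum of `∑_j |c_j|` over all
decompositions into central atoms (`∞` when there is none). -/
def atomicENorm {n : ℕ} (p : ℝ) (f : Rn n → ℂ) : ℝ≥0∞ :=
  ⨅ (c : ℕ → ℂ) (a : ℕ → Rn n → ℂ) (_ : IsAtomicDecomposition p f c a), ∑' j, ‖c j‖ₑ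

/-- `f ∈ L¹` has a decomposition into central atoms. -/
def MemAtomic {n : ℕ} (p : ℝ) (f : Rn n → ℂ) : Prop :=
  Integrable f volume ∧ ∃ c a, IsAtomicDecomposition p f c a

end HerzHardy

end

namespace HerzHardy

open Filter Topology

variable {n : ℕ}

/-! On the annulus `C_k` the prefactor of `𝓗 f` is of order `2 ^ (-k n)`, which cancels `2 ^ (k n /
p') |C_k| ^ (1 / p)`. Hence `‖𝓗 f‖_{K_p}` is at most a constant times `∑ d k`, where `d k` bounds
the integrals of `f` over balls of radius in `(2 ^ (k - 1), 2 ^ k]` (`herzENorm_hardyOp_le`). Both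
halves reduce to a summable choice of `d`.

Grand maximal function: replacing the sharp cutoff by a smooth bump costs at most `∫_{C_k} |f|`, and
the smooth integral is `≲ 2 ^ (k n) G_N f(x')` for every `x' ∈ C_k`, hence `≲ ∫_{C_k} G_N f`. Since
`|f| ≲ G_N f` almost everywhere, `d k` is a multiple of `∫_{C_k} G_N f`, and Hölder on each annulus
sums these to the Herz norm.

Atoms: once the ball contains the support, the cancellation makes the integral vanish; for smaller
balls Hölder gives `(2 ^ k / r) ^ (n / p')`. This geometric series has a bound independent of `r`.
-/

lemma measurableSet_annulus (n : ℕ) (k : ℤ) : MeasurableSet (annulus n k) :=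
  measurableSet_closedBall.diff measurableSet_closedBall

lemma mem_annulus {k : ℤ} {x : Rn n} :
    x ∈ annulus n k ↔ (2 : ℝ) ^ (k - 1) < ‖x‖ ∧ ‖x‖ ≤ (2 : ℝ) ^ k := by
  simp [annulus, and_comm]

lemma volume_real_unitBall_pos (n : ℕ) : 0 < volume.real (ball (0 : Rn n) 1) :=
  ENNReal.toReal_pos (measure_ball_pos _ _ one_pos).ne' measure_ball_lt_top.ne

lemma volume_closedBall_eq (n : ℕ) {r : ℝ} (hr : 0 ≤ r) :
    volume (closedBall (0 : Rn n) r)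
      = ENNReal.ofReal (r ^ n * volume.real (ball (0 : Rn n) 1)) := by
  rw [Measure.addHaar_closedBall _ _ hr, ENNReal.ofReal_mul (by positivity), finrank_euclideanSpace,
    Fintype.card_fin, ofReal_measureReal measure_ball_lt_top.ne]

lemma volume_annulus_le (n : ℕ) (k : ℤ) :
    volume (annulus n k)
      ≤ ENNReal.ofReal (((2 : ℝ) ^ k) ^ n * volume.real (ball (0 : Rn n) 1)) :=
  (measure_mono sdiff_subset).trans (volume_closedBall_eq n (by positivity)).le

lemma le_volume_annulus (hn : 1 ≤ n) (k : ℤ) :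
    ENNReal.ofReal (((2 : ℝ) ^ (k - 1)) ^ n * volume.real (ball (0 : Rn n) 1))
      ≤ volume (annulus n k) := by
  have hv := volume_real_unitBall_pos n
  rw [annulus, measure_sdiff (closedBall_subset_closedBall
    (zpow_le_zpow_right₀ one_le_two (by lia))) measurableSet_closedBall.nullMeasurableSet
    measure_closedBall_lt_top.ne, volume_closedBall_eq n (by positivity),
    volume_closedBall_eq n (by positivity), ← ENNReal.ofReal_sub _ (by positivity)]
  apply ENNReal.ofReal_le_ofReal
  have h2 : (2 : ℝ) ^ k = 2 * 2 ^ (k - 1) := by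
    rw [← zpow_one_add₀ two_ne_zero]; congr 1; ring
  have h3 : (2 : ℝ) ≤ 2 ^ n := le_self_pow₀ one_le_two (by lia)
  have h4 : 0 < ((2 : ℝ) ^ (k - 1)) ^ n * volume.real (ball (0 : Rn n) 1) := by positivity
  rw [h2, mul_pow]
  nlinarith

lemma two_rpow_zpow_mul (k : ℤ) (n : ℕ) (q : ℝ) :
    (((2 : ℝ) ^ k) ^ n) ^ q = (2 : ℝ) ^ ((k : ℝ) * n * q) := by
  rw [← Real.rpow_intCast, ← Real.rpow_mul_natCast two_pos.le, ← Real.rpow_mul two_pos.le]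

lemma one_div_add_one_div_conjExponent {p : ℝ} (hp : 1 < p) :
    1 / p + 1 / Real.conjExponent p = 1 := by
  simpa using (Real.HolderConjugate.conjExponent hp).inv_add_inv_eq_one

lemma conjExponent_pos {p : ℝ} (hp : 1 < p) : 0 < Real.conjExponent p :=
  (Real.HolderConjugate.conjExponent hp).symm.pos

/-! ### Reduction to partial integrals, measurability and Hölder -/

/-- If the partial integrals of `f` are bounded by `d k` on the `k`-th annulus, then the Herz norm
of `𝓗 f` is controlled by `∑ d k`. -/
lemma herzENorm_hardyOp_le {p : ℝ} (hp : 1 < p) {f : Rn n → ℂ} {d : ℤ → ℝ≥0∞}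
    (h : ∀ k, ∀ x ∈ annulus n k, ‖∫ y in ball (0 : Rn n) ‖x‖, f y‖ₑ ≤ d k) :
    herzENorm p (hardyOp f) ≤
      ENNReal.ofReal (2 ^ n * volume.real (ball (0 : Rn n) 1) ^ (1 / p - 1)) * ∑' k, d k := by
  rw [← ENNReal.tsum_mul_left]
  refine ENNReal.tsum_le_tsum fun k => ?_
  have hv := volume_real_unitBall_pos n
  set v := volume.real (ball (0 : Rn n) 1) with hvdef
  have hp0 : 0 < p := by linarith
  set b : ℝ := (v * ((2 : ℝ) ^ (k - 1)) ^ n)⁻¹ with hb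
  have hpt : ∀ x, ‖(annulus n k).indicator (hardyOp f) x‖ₑ ≤
      ‖(annulus n k).indicator (fun _ => ENNReal.ofReal b * d k) x‖ₑ := by
    intro x
    by_cases hx : x ∈ annulus n k
    · rw [indicator_of_mem hx, indicator_of_mem hx, hardyOp, enorm_smul, enorm_eq_self]
      have hx' := mem_annulus.1 hx
      have h2 : (0 : ℝ) < 2 ^ (k - 1) := by positivity
      gcongr
      · rw [Real.enorm_of_nonneg (by positivity)]
        apply ENNReal.ofReal_le_ofReal
        rw [hb]
        gcongr
        exact hx'.1.le
      · exact h k x hx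
    · simp [hx]
  have hA := (eLpNorm_mono_enorm (p := ENNReal.ofReal p) (μ := volume) hpt).trans
    (eLpNorm_indicator_const_le _ _)
  rw [ENNReal.toReal_ofReal hp0.le, enorm_eq_self] at hA
  have hB : volume (annulus n k) ^ (1 / p) ≤ ENNReal.ofReal ((((2 : ℝ) ^ k) ^ n * v) ^ (1 / p)) := by
    rw [← ENNReal.ofReal_rpow_of_nonneg (by positivity) (by positivity)]
    exact ENNReal.rpow_le_rpow (volume_annulus_le n k) (by positivity)
  calc _ ≤ ENNReal.ofReal ((2 : ℝ) ^ ((k : ℝ) * (n : ℝ) / Real.conjExponent p)) *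
        (ENNReal.ofReal b * d k * ENNReal.ofReal ((((2 : ℝ) ^ k) ^ n * v) ^ (1 / p))) := by
        gcongr
        exact hA.trans (by gcongr)
    _ = ENNReal.ofReal ((2 : ℝ) ^ ((k : ℝ) * (n : ℝ) / Real.conjExponent p) * b *
          (((2 : ℝ) ^ k) ^ n * v) ^ (1 / p)) * d k := by
        rw [ENNReal.ofReal_mul (by positivity), ENNReal.ofReal_mul (by positivity)]
        ring
    _ = _ := by
        -- The powers of `2 ^ k` cancel since `1 / p + 1 / p' = 1`; the factor `2 ^ n` remains
        -- because `b` uses the inner radius `2 ^ (k - 1)`.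
        congr 2
        have h1 : (2 : ℝ) ^ k = 2 * 2 ^ (k - 1) := by
          rw [← zpow_one_add₀ two_ne_zero]; congr 1; ring
        have h2 : (2 : ℝ) ^ ((k : ℝ) * (n : ℝ) / Real.conjExponent p) =
            (((2 : ℝ) ^ k) ^ n) ^ (1 / Real.conjExponent p) := by
          rw [two_rpow_zpow_mul]; congr 1; ring
        have h3 : (((2 : ℝ) ^ k) ^ n) ^ (1 / Real.conjExponent p) * (((2 : ℝ) ^ k) ^ n) ^ (1 / p)
            = 2 ^ n * ((2 : ℝ) ^ (k - 1)) ^ n := by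
          rw [← Real.rpow_add (by positivity), add_comm, one_div_add_one_div_conjExponent hp,
            Real.rpow_one, h1, mul_pow]
        rw [h2, Real.mul_rpow (by positivity) hv.le, Real.rpow_sub hv, Real.rpow_one, hb]
        calc _ = ((((2 : ℝ) ^ k) ^ n) ^ (1 / Real.conjExponent p) *
              (((2 : ℝ) ^ k) ^ n) ^ (1 / p)) * (v * ((2 : ℝ) ^ (k - 1)) ^ n)⁻¹ * v ^ (1 / p) := by
              ring
          _ = _ := by
              rw [h3]
              field_simp

lemma aestronglyMeasurable_hardyOp {f : Rn n → ℂ} (hf : Integrable f volume) :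
    AEStronglyMeasurable (hardyOp f) volume := by
  have hS : MeasurableSet {q : Rn n × Rn n | ‖q.2‖ < ‖q.1‖} :=
    (isOpen_lt (by fun_prop) (by fun_prop)).measurableSet
  have h1 : AEStronglyMeasurable
      ({q : Rn n × Rn n | ‖q.2‖ < ‖q.1‖}.indicator fun q => f q.2) (volume.prod volume) :=
    (hf.aestronglyMeasurable.comp_snd).indicator hS
  have h2 := h1.integral_prod_right'
  have h3 : (fun x : Rn n => ∫ y, {q : Rn n × Rn n | ‖q.2‖ < ‖q.1‖}.indicator (fun q => f q.2) (x, y))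
      = fun x => ∫ y in ball (0 : Rn n) ‖x‖, f y := by
    ext x
    rw [← integral_indicator measurableSet_ball]
    refine integral_congr_ae (Eventually.of_forall fun y => ?_)
    simp [indicator]
  rw [h3] at h2
  refine AEStronglyMeasurable.smul (f := fun x : Rn n =>
    ((volume.real (ball (0 : Rn n) 1) * ‖x‖ ^ n)⁻¹ : ℝ)) ?_ h2
  exact Measurable.aestronglyMeasurable (by fun_prop)

/-- Hölder against the constant `1`. The general codomain serves both complex atoms and the `[0,
∞]`-valued maximal function. -/
lemma setLIntegral_le_eLpNorm_mul {p : ℝ} (hp : 1 < p) {ε : Type*} [TopologicalSpace ε]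
    [ESeminormedAddMonoid ε] {g : Rn n → ε} {s : Set (Rn n)} (hs : MeasurableSet s)
    (hg : AEStronglyMeasurable g volume) :
    ∫⁻ x in s, ‖g x‖ₑ ≤ eLpNorm (s.indicator g) (ENNReal.ofReal p) volume *
      volume s ^ (1 / Real.conjExponent p) := by
  have h := eLpNorm_le_eLpNorm_mul_rpow_measure_univ (p := 1) (q := ENNReal.ofReal p)
    (μ := volume.restrict s) (by simpa using hp.le) hg.restrict
  rw [eLpNorm_one_eq_lintegral_enorm, ← eLpNorm_indicator_eq_eLpNorm_restrict hs,
    Measure.restrict_apply_univ, ENNReal.toReal_ofReal (by linarith)] at h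
  convert h using 3
  have := one_div_add_one_div_conjExponent hp
  simp only [ENNReal.toReal_one]
  linarith

/-! ### The grand maximal function -/

/-- The supremum is uncountable, but each cone condition is open in `x`, so every term is lower
semicontinuous, and this survives suprema. -/
lemma measurable_grandMaximal (N : ℕ) (f : Rn n → ℂ) : Measurable (grandMaximal N f) := by
  refine LowerSemicontinuous.measurable (lowerSemicontinuous_iSup fun φ =>
    lowerSemicontinuous_iSup fun _ => lowerSemicontinuous_iSup fun t =>
    lowerSemicontinuous_iSup fun y => ?_)
  have hopen : IsOpen {x : Rn n | 0 < t ∧ ‖y - x‖ < t} :=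
    isOpen_const.and (isOpen_lt (by fun_prop) (by fun_prop))
  convert! hopen.lowerSemicontinuous_indicator (zero_le (a := ‖dilConv f φ t y‖ₑ)) using 1
  ext x
  by_cases hx : 0 < t ∧ ‖y - x‖ < t <;> simp [hx]

lemma enorm_dilConv_le_grandMaximal {N : ℕ} {f : Rn n → ℂ} {φ : 𝓢(Rn n, ℂ)}
    (hφ : φ ∈ testClass n N) {t : ℝ} (ht : 0 < t) {x y : Rn n} (hxy : ‖y - x‖ < t) :
    ‖dilConv f φ t y‖ₑ ≤ grandMaximal N f x :=
  le_iSup₂_of_le φ hφ <| le_iSup₂_of_le t y <| le_iSup_of_le ⟨ht, hxy⟩ le_rfl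

/-- Every Schwartz function has a positive multiple in the class `𝓐_N`. -/
lemma exists_smul_mem_testClass (N : ℕ) (φ : 𝓢(Rn n, ℂ)) :
    ∃ c : ℝ, 0 < c ∧ c • φ ∈ testClass n N := by
  choose B hB using φ.decay'
  have hB0 : ∀ j m, 0 ≤ B j m := fun j m => le_trans (by positivity) (hB j m 0)
  set S := ∑ j ∈ Finset.range (N + 1), ∑ m ∈ Finset.range (N + 1), B j m with hS
  have hS0 : 0 ≤ S := Finset.sum_nonneg fun j _ => Finset.sum_nonneg fun m _ => hB0 j m
  refine ⟨(S + 1)⁻¹, by positivity, fun j hj m hm x => ?_⟩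
  have h1 : B j m ≤ S := by
    refine (Finset.single_le_sum (f := fun m => B j m) (fun m _ => hB0 j m)
      (Finset.mem_range.2 (Nat.lt_succ_of_le hm))).trans ?_
    exact Finset.single_le_sum (f := fun j => ∑ m ∈ Finset.range (N + 1), B j m)
      (fun j _ => Finset.sum_nonneg fun m _ => hB0 j m) (Finset.mem_range.2 (Nat.lt_succ_of_le hj))
  have h2 : iteratedFDeriv ℝ m (⇑((S + 1)⁻¹ • φ)) x = (S + 1)⁻¹ • iteratedFDeriv ℝ m φ x := by
    rw [FunLike.coe_smul, iteratedFDeriv_const_smul_apply]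
    exact (φ.smooth m).contDiffAt
  rw [h2, norm_smul, Real.norm_of_nonneg (by positivity)]
  calc _ = (S + 1)⁻¹ * (‖x‖ ^ j * ‖iteratedFDeriv ℝ m φ x‖) := by ring
    _ ≤ (S + 1)⁻¹ * (S + 1) := by
      gcongr
      exact (hB j m x).trans (by linarith)
    _ = 1 := inv_mul_cancel₀ (by positivity)

/-- The bump function equal to `1` on `B(0, t / 4)` and supported in `B(0, t / 2)`. -/
noncomputable def dilBump (n : ℕ) (t : ℝ) (ht : 0 < t) : ContDiffBump (0 : Rn n) :=
  ⟨t / 4, t / 2, by positivity, by linarith⟩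

/-- The ratio of the radii does not depend on `t`, so all these bumps are dilates of one function
and a single element of `𝓐_N` tests every scale. -/
lemma dilBump_apply {t : ℝ} (ht : 0 < t) (x : Rn n) :
    dilBump n t ht x = dilBump n 1 one_pos (t⁻¹ • x) := by
  rw [ContDiffBump.apply, ContDiffBump.apply]
  have h1 : t / 2 / (t / 4) = 1 / 2 / (1 / 4) := by field_simp
  have h2 : (t / 4)⁻¹ = (1 / 4)⁻¹ * t⁻¹ := by field_simp
  simp only [dilBump, sub_zero, smul_smul, h1, h2]

lemma integral_dilBump {t : ℝ} (ht : 0 < t) :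
    ∫ x, dilBump n t ht x = t ^ n * ∫ x, dilBump n 1 one_pos x := by
  simp_rw [dilBump_apply ht]
  rw [Measure.integral_comp_inv_smul_of_nonneg volume (fun x => dilBump n 1 one_pos x) ht.le,
    finrank_euclideanSpace, Fintype.card_fin, smul_eq_mul]

/-- A positive multiple of the bump function of scale one belongs to `𝓐_N`. -/
lemma exists_bump_mem_testClass (n N : ℕ) : ∃ c : ℝ, 0 < c ∧ ∃ φ ∈ testClass n N,
    ∀ x : Rn n, φ x = ((c * dilBump n 1 one_pos x : ℝ) : ℂ) := by
  have h1 : ContDiff ℝ (⊤ : ℕ∞) (fun x : Rn n => (dilBump n 1 one_pos x : ℂ)) :=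
    Complex.ofRealCLM.contDiff.comp (dilBump n 1 one_pos).contDiff
  have h2 : HasCompactSupport (fun x : Rn n => (dilBump n 1 one_pos x : ℂ)) :=
    (dilBump n 1 one_pos).hasCompactSupport.comp_left Complex.ofReal_zero
  obtain ⟨c, hc, hφ⟩ := exists_smul_mem_testClass N (h2.toSchwartzMap h1)
  exact ⟨c, hc, _, hφ, fun x => by simp⟩

lemma dilConv_bump {c : ℝ} {φ : 𝓢(Rn n, ℂ)}
    (hφ : ∀ x : Rn n, φ x = ((c * dilBump n 1 one_pos x : ℝ) : ℂ)) (f : Rn n → ℂ) {t : ℝ}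
    (ht : 0 < t) (y : Rn n) :
    dilConv f φ t y = ((t ^ n)⁻¹ * c : ℝ) • ∫ z, dilBump n t ht (y - z) • f z := by
  rw [dilConv, ← integral_smul]
  refine integral_congr_ae (Eventually.of_forall fun z => ?_)
  simp only [hφ, dilBump_apply ht (y - z), Complex.real_smul]
  push_cast
  ring

/-- The grand maximal function dominates a multiple of `|f|` almost everywhere. -/
lemma ae_enorm_le_grandMaximal (n N : ℕ) : ∃ K : ℝ≥0, ∀ f : Rn n → ℂ, Integrable f volume →
    ∀ᵐ x, ‖f x‖ₑ ≤ K * grandMaximal N f x := by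
  obtain ⟨c, hc, φ, hφN, hφ⟩ := exists_bump_mem_testClass n N
  have hI : 0 < ∫ x, dilBump n 1 one_pos x := ContDiffBump.integral_pos _
  set I := ∫ x, dilBump n 1 one_pos x with hIdef
  refine ⟨(c * I)⁻¹.toNNReal, fun f hf => ?_⟩
  have hlim : Tendsto (fun i : ℕ => 1 / ((i : ℝ) + 1)) atTop (𝓝 0) :=
    tendsto_one_div_add_atTop_nhds_zero_nat
  -- Lebesgue differentiation along normalized bumps; `K = 2` is the ratio of outer to inner radius.
  have key := ContDiffBump.ae_convolution_tendsto_right_of_locallyIntegrable (μ := volume)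
    (φ := fun i : ℕ => dilBump n (1 / ((i : ℝ) + 1)) (by positivity)) (l := atTop) (K := 2)
    (by simpa [dilBump] using hlim.div_const 2)
    (Eventually.of_forall fun i => by simp only [dilBump]; apply le_of_eq; ring)
    hf.locallyIntegrable
  filter_upwards [key] with x hx
  refine le_of_tendsto hx.enorm (Eventually.of_forall fun i => ?_)
  have ht : (0 : ℝ) < 1 / ((i : ℝ) + 1) := by positivity
  set t : ℝ := 1 / ((i : ℝ) + 1)
  have hG := enorm_dilConv_le_grandMaximal (f := f) hφN ht (x := x) (y := x) (by simpa using ht)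
  have h1 : convolution ((dilBump n t ht).normed volume) f (ContinuousLinearMap.lsmul ℝ ℝ) volume x
      = (c * I)⁻¹ • dilConv f φ t x := by
    rw [convolution_eq_swap, dilConv_bump hφ f ht, smul_smul, ← integral_smul]
    refine integral_congr_ae (Eventually.of_forall fun z => ?_)
    simp only [ContinuousLinearMap.lsmul_apply, ContDiffBump.normed_def, integral_dilBump ht,
      smul_smul, ← hIdef]
    congr 1
    field_simp
  rw [h1, enorm_smul, Real.enorm_of_nonneg (by positivity)]
  exact mul_le_mul_right hG _

/-- Up to the mass of `f` on the `k`-th annulus, the partial integrals of `f` over balls whose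
radius lies in the `k`-th dyadic interval are controlled by the grand maximal function. -/
lemma exists_setIntegral_ball_le (n N : ℕ) : ∃ K : ℝ≥0, ∀ f : Rn n → ℂ, Integrable f volume →
    ∀ k : ℤ, ∀ x ∈ annulus n k, ∀ x' ∈ annulus n k,
      ‖∫ y in ball (0 : Rn n) ‖x‖, f y‖ₑ ≤
        K * ENNReal.ofReal (((2 : ℝ) ^ (k - 1)) ^ n) * grandMaximal N f x'
          + ∫⁻ y in annulus n k, ‖f y‖ₑ := by
  obtain ⟨c, hc, φ, hφN, hφ⟩ := exists_bump_mem_testClass n N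
  refine ⟨(4 ^ n / c).toNNReal, fun f hf k x hx x' hx' => ?_⟩
  have hxk := mem_annulus.1 hx
  have hxk' := mem_annulus.1 hx'
  have ht : (0 : ℝ) < 2 ^ (k + 1) := by positivity
  have h21 : (2 : ℝ) ^ k = 2 * 2 ^ (k - 1) := by
    rw [← zpow_one_add₀ two_ne_zero]; congr 1; ring
  have h22 : (2 : ℝ) ^ (k + 1) = 4 * 2 ^ (k - 1) := by
    rw [zpow_add_one₀ two_ne_zero, h21]; ring
  have hr : (0 : ℝ) < 2 ^ (k - 1) := by positivity
  -- At scale `2 ^ (k + 1)` the radii of the bump are exactly those of the annulus, and the scale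
  -- exceeds `‖x'‖`, so the point `0` is admissible in the cone at `x'`.
  set ψ := dilBump n ((2 : ℝ) ^ (k + 1)) ht with hψ
  have hψin : ψ.rIn = 2 ^ (k - 1) := by simp only [hψ, dilBump, h22]; ring
  have hψout : ψ.rOut = 2 ^ k := by simp only [hψ, dilBump, h22, h21]; ring
  have hint : Integrable (fun y => ψ y • f y) volume := by
    refine hf.bdd_smul 1 ψ.continuous.aestronglyMeasurable
      (Eventually.of_forall fun y => ?_)
    rw [Real.norm_of_nonneg ψ.nonneg]
    exact ψ.le_one
  have hG := enorm_dilConv_le_grandMaximal (f := f) hφN ht (x := x') (y := 0)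
    (by rw [zero_sub, norm_neg, h22]; linarith)
  have hsmooth : ∫ y, ψ y • f y
      = (4 ^ n / c * ((2 : ℝ) ^ (k - 1)) ^ n) • dilConv f φ (2 ^ (k + 1)) 0 := by
    rw [dilConv_bump hφ f ht, smul_smul]
    simp only [zero_sub, ContDiffBump.neg, ← hψ]
    rw [h22, mul_pow]
    convert (one_smul ℝ _).symm using 2
    field_simp
  have hsplit : ∫ y in ball (0 : Rn n) ‖x‖, f y = (∫ y, ψ y • f y) +
      ∫ y, ((ball (0 : Rn n) ‖x‖).indicator f y - ψ y • f y) := by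
    rw [integral_sub (hf.indicator measurableSet_ball) hint, integral_indicator measurableSet_ball]
    ring
  have hrest : ‖∫ y, ((ball (0 : Rn n) ‖x‖).indicator f y - ψ y • f y)‖ₑ
      ≤ ∫⁻ y in annulus n k, ‖f y‖ₑ := by
    refine (enorm_integral_le_lintegral_enorm _).trans ?_
    rw [← lintegral_indicator (measurableSet_annulus n k)]
    refine lintegral_mono fun y => ?_
    -- Both cutoffs equal `1` inside the annulus and `0` outside it, so they differ only on it, by
    -- at most `1`.
    by_cases hy : y ∈ annulus n k
    · rw [indicator_of_mem hy, enorm_le_iff_norm_le]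
      by_cases hyx : y ∈ ball (0 : Rn n) ‖x‖
      · rw [indicator_of_mem hyx]
        have : f y - ψ y • f y = (1 - ψ y) • f y := by rw [sub_smul, one_smul]
        rw [this, norm_smul, Real.norm_of_nonneg (by linarith [ψ.le_one (x := y)])]
        exact mul_le_of_le_one_left (norm_nonneg _) (by linarith [ψ.nonneg (x := y)])
      · rw [indicator_of_notMem hyx, zero_sub, norm_neg, norm_smul, Real.norm_of_nonneg ψ.nonneg]
        exact mul_le_of_le_one_left (norm_nonneg _) ψ.le_one
    · rw [indicator_of_notMem hy]
      rw [mem_annulus, not_and, not_le] at hy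
      by_cases hyk : ‖y‖ ≤ 2 ^ (k - 1)
      · rw [indicator_of_mem (by simpa using hyk.trans_lt hxk.1),
          ψ.one_of_mem_closedBall (by simpa [hψin] using hyk)]
        simp
      · have hyk' := hy (not_le.1 hyk)
        rw [indicator_of_notMem (by simpa using hxk.2.trans hyk'.le),
          ψ.zero_of_le_dist (by simpa [hψout] using hyk'.le)]
        simp
  rw [hsplit]
  refine (enorm_add_le _ _).trans (add_le_add ?_ hrest)
  rw [hsmooth, enorm_smul, Real.enorm_of_nonneg (by positivity),
    ENNReal.ofReal_mul (by positivity)]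
  exact mul_le_mul_right hG _

/-- The partial integrals of `f` over balls are controlled by the mass of the grand maximal function
on the corresponding annulus. -/
lemma exists_setIntegral_ball_le_lintegral_grandMaximal (hn : 1 ≤ n) (N : ℕ) :
    ∃ K : ℝ≥0, ∀ f : Rn n → ℂ, Integrable f volume → ∀ k : ℤ, ∀ x ∈ annulus n k,
      ‖∫ y in ball (0 : Rn n) ‖x‖, f y‖ₑ ≤ K * ∫⁻ y in annulus n k, grandMaximal N f y := by
  obtain ⟨K₁, hK₁⟩ := ae_enorm_le_grandMaximal n N
  obtain ⟨K₂, hK₂⟩ := exists_setIntegral_ball_le n N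
  have hv := volume_real_unitBall_pos n
  set v := volume.real (ball (0 : Rn n) 1) with hvdef
  refine ⟨K₂ * v⁻¹.toNNReal + K₁, fun f hf k x hx => ?_⟩
  set G := ∫⁻ y in annulus n k, grandMaximal N f y with hG
  have hr : (0 : ℝ) < 2 ^ (k - 1) := by positivity
  have hf1 : ∫⁻ y in annulus n k, ‖f y‖ₑ ≤ K₁ * G := by
    rw [hG, ← lintegral_const_mul _ (measurable_grandMaximal N f)]
    exact lintegral_mono_ae (ae_restrict_of_ae (hK₁ f hf))
  -- The partial integral does not depend on `x'`, so the infimum may be taken; it is at most the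
  -- average of `G_N f` over the annulus.
  set J := ⨅ y ∈ annulus n k, grandMaximal N f y with hJ
  have hJG : ENNReal.ofReal (((2 : ℝ) ^ (k - 1)) ^ n) * J ≤ ENNReal.ofReal v⁻¹ * G := by
    have h1 : J * volume (annulus n k) ≤ G := by
      rw [← setLIntegral_const]
      exact setLIntegral_mono (measurable_grandMaximal N f) fun y hy => iInf₂_le y hy
    calc _ = ENNReal.ofReal v⁻¹ * (J * ENNReal.ofReal (((2 : ℝ) ^ (k - 1)) ^ n * v)) := by
          rw [mul_left_comm, ← ENNReal.ofReal_mul (by positivity), mul_comm]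
          congr 2
          field_simp
      _ ≤ _ := by
          gcongr
          exact le_trans (by gcongr; exact le_volume_annulus hn k) h1
  have hx2 : ‖∫ y in ball (0 : Rn n) ‖x‖, f y‖ₑ ≤
      K₂ * ENNReal.ofReal (((2 : ℝ) ^ (k - 1)) ^ n) * J + ∫⁻ y in annulus n k, ‖f y‖ₑ := by
    have hne : (K₂ : ℝ≥0∞) * ENNReal.ofReal (((2 : ℝ) ^ (k - 1)) ^ n) ≠ ∞ :=
      ENNReal.mul_ne_top ENNReal.coe_ne_top ENNReal.ofReal_ne_top
    rw [← tsub_le_iff_right]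
    have : Nonempty (annulus n k) := ⟨⟨x, hx⟩⟩
    rw [hJ, iInf_subtype', ENNReal.mul_iInf' (fun h => absurd h hne) fun _ => this]
    exact le_iInf fun x' => tsub_le_iff_right.2 (hK₂ f hf k x hx x' x'.2)
  calc _ ≤ K₂ * (ENNReal.ofReal v⁻¹ * G) + K₁ * G := by
        refine hx2.trans (add_le_add ?_ hf1)
        rw [mul_assoc]
        gcongr
    _ = _ := by
        rw [ENNReal.coe_add, ENNReal.coe_mul, ENNReal.ofReal]
        ring

lemma tsum_lintegral_annulus_le {p : ℝ} (hp : 1 < p) {g : Rn n → ℝ≥0∞} (hg : Measurable g) :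
    ∑' k, ∫⁻ y in annulus n k, g y ≤
      ENNReal.ofReal (volume.real (ball (0 : Rn n) 1) ^ (1 / Real.conjExponent p)) *
        herzENorm p g := by
  rw [herzENorm, ← ENNReal.tsum_mul_left]
  refine ENNReal.tsum_le_tsum fun k => ?_
  have hv := volume_real_unitBall_pos n
  have hq := conjExponent_pos hp
  have h1 := setLIntegral_le_eLpNorm_mul hp (measurableSet_annulus n k)
    hg.aestronglyMeasurable
  simp only [enorm_eq_self] at h1
  refine h1.trans ?_
  rw [← mul_assoc, ← ENNReal.ofReal_mul (by positivity), mul_comm]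
  gcongr
  refine (ENNReal.rpow_le_rpow (volume_annulus_le n k) (by positivity)).trans ?_
  rw [ENNReal.ofReal_rpow_of_nonneg (by positivity) (by positivity),
    Real.mul_rpow (by positivity) hv.le, two_rpow_zpow_mul, mul_comm, mul_one_div]

lemma exists_herzENorm_hardyOp_le_hardyHerzENorm (hn : 1 ≤ n) {p : ℝ} (hp : 1 < p) (N : ℕ) :
    ∃ C : ℝ≥0, ∀ f : Rn n → ℂ, Integrable f volume →
      herzENorm p (hardyOp f) ≤ C * hardyHerzENorm N p f := by
  obtain ⟨K, hK⟩ := exists_setIntegral_ball_le_lintegral_grandMaximal hn N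
  refine ⟨(2 ^ n * volume.real (ball (0 : Rn n) 1) ^ (1 / p - 1)).toNNReal *
    (K * (volume.real (ball (0 : Rn n) 1) ^ (1 / Real.conjExponent p)).toNNReal), fun f hf => ?_⟩
  refine (herzENorm_hardyOp_le hp (hK f hf)).trans ?_
  rw [ENNReal.tsum_mul_left, ENNReal.coe_mul, ENNReal.coe_mul, mul_assoc, mul_assoc]
  gcongr
  · rfl
  · exact tsum_lintegral_annulus_le hp (measurable_grandMaximal N f)

/-! ### Atoms and atomic decompositions -/

/-- The majorant of the partial integrals, over balls of radius comparable with `2 ^ k`, of an atom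
living on the ball of radius `r`; here `θ = n / p'`. -/
noncomputable def atomMajorant (θ r : ℝ) (k : ℤ) : ℝ≥0∞ :=
  if (2 : ℝ) ^ (k - 1) < r then ENNReal.ofReal (((2 : ℝ) ^ k / r) ^ θ) else 0

lemma exists_tsum_atomMajorant_le {θ : ℝ} (hθ : 0 < θ) :
    ∃ C : ℝ≥0, ∀ r : ℝ, 0 < r → ∑' k, atomMajorant θ r k ≤ C := by
  have hlt : ENNReal.ofReal ((2 : ℝ) ^ (-θ)) < 1 := by
    rw [ENNReal.ofReal_lt_one]
    exact Real.rpow_lt_one_of_one_lt_of_neg one_lt_two (by linarith)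
  have hfin : ENNReal.ofReal ((2 : ℝ) ^ θ) * (1 - ENNReal.ofReal ((2 : ℝ) ^ (-θ)))⁻¹ ≠ ∞ :=
    ENNReal.mul_ne_top ENNReal.ofReal_ne_top (ENNReal.inv_ne_top.2 (tsub_pos_of_lt hlt).ne')
  refine ⟨_, fun r hr => (?_ : _ ≤ _).trans (ENNReal.coe_toNNReal hfin).ge⟩
  obtain ⟨K, hK1, hK2⟩ := exists_mem_Ioc_zpow hr (one_lt_two (α := ℝ))
  -- With `2 ^ K < r ≤ 2 ^ (K + 1)`, nonzero terms have `k ≤ K + 1`. Counting down by `m` from `K +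
  -- 1` bounds them by a geometric series of ratio `2 ^ (-θ)`.
  have hinj : Function.Injective fun m : ℕ => K + 1 - (m : ℤ) := fun a b h => by
    simpa using h
  have hsupp : Function.support (atomMajorant θ r) ⊆ range fun m : ℕ => K + 1 - (m : ℤ) := by
    intro k hk
    have hk' : (2 : ℝ) ^ (k - 1) < r := by
      by_contra h
      exact hk (by simp [atomMajorant, h])
    have := (zpow_lt_zpow_iff_right₀ one_lt_two).1 (hk'.trans_le hK2)
    exact ⟨(K + 1 - k).toNat, by simp only; lia⟩
  rw [← hinj.tsum_eq hsupp, ← ENNReal.tsum_geometric, ← ENNReal.tsum_mul_left]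
  refine ENNReal.tsum_le_tsum fun m => ?_
  rw [atomMajorant]
  split_ifs
  · rw [← ENNReal.ofReal_pow (by positivity), ← ENNReal.ofReal_mul (by positivity)]
    apply ENNReal.ofReal_le_ofReal
    have h1 : (2 : ℝ) ^ (K + 1 - (m : ℤ)) / r ≤ 2 * (2 ^ m)⁻¹ := by
      rw [div_le_iff₀ hr, zpow_sub₀ two_ne_zero, zpow_add_one₀ two_ne_zero, zpow_natCast,
        div_eq_mul_inv]
      have : (0 : ℝ) < 2 * (2 ^ m)⁻¹ := by positivity
      nlinarith
    calc _ ≤ (2 * ((2 : ℝ) ^ m)⁻¹) ^ θ := by gcongr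
      _ = _ := by
        rw [Real.mul_rpow (by positivity) (by positivity), Real.inv_rpow (by positivity),
          Real.rpow_neg (by positivity), inv_pow, ← Real.rpow_natCast, ← Real.rpow_natCast,
          ← Real.rpow_mul (by positivity), ← Real.rpow_mul (by positivity), mul_comm θ]
  · exact zero_le

/-- Since `1 / p - 1 = -1 / p'`, Hölder leaves the ratio of the two ball volumes to the power `1 /
p'`. -/
lemma setLIntegral_closedBall_le_of_eLpNorm_le {p : ℝ} (hp : 1 < p) {a : Rn n → ℂ}
    (ha : AEStronglyMeasurable a volume) {r : ℝ} (hr : 0 < r)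
    (har : eLpNorm a (ENNReal.ofReal p) volume ≤ volume (ball (0 : Rn n) r) ^ (1 / p - 1))
    {R : ℝ} (hR : 0 < R) :
    ∫⁻ x in closedBall (0 : Rn n) R, ‖a x‖ₑ
      ≤ ENNReal.ofReal ((R / r) ^ ((n : ℝ) / Real.conjExponent p)) := by
  have hv := volume_real_unitBall_pos n
  have hq := conjExponent_pos hp
  refine (setLIntegral_le_eLpNorm_mul hp measurableSet_closedBall ha).trans ?_
  have hball : volume (ball (0 : Rn n) r)
      = ENNReal.ofReal (r ^ n * volume.real (ball (0 : Rn n) 1)) := by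
    rw [Measure.addHaar_ball_of_pos _ _ hr, ENNReal.ofReal_mul (by positivity),
      finrank_euclideanSpace, Fintype.card_fin, ofReal_measureReal measure_ball_lt_top.ne]
  have hexp : 1 / p - 1 = -(1 / Real.conjExponent p) := by
    linarith [one_div_add_one_div_conjExponent hp]
  have h1 := (eLpNorm_indicator_le (s := closedBall (0 : Rn n) R) a).trans har
  rw [hball, hexp, ENNReal.ofReal_rpow_of_pos (by positivity)] at h1
  rw [volume_closedBall_eq n hR.le]
  rw [ENNReal.ofReal_rpow_of_pos (by positivity)]
  refine (mul_le_mul_left h1 _).trans_eq ?_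
  rw [← ENNReal.ofReal_mul (by positivity)]
  congr 1
  rw [Real.rpow_neg (by positivity), Real.mul_rpow (by positivity) hv.le,
    Real.mul_rpow (by positivity) hv.le, Real.div_rpow hR.le hr.le, div_eq_mul_one_div (n : ℝ),
    Real.rpow_mul hR.le, Real.rpow_mul hr.le, Real.rpow_natCast, Real.rpow_natCast]
  field_simp

lemma IsCentralAtom.lintegral_enorm_le {p : ℝ} (hp : 1 < p) {a : Rn n → ℂ}
    (ha : IsCentralAtom p a) : ∫⁻ x, ‖a x‖ₑ ≤ 1 := by
  obtain ⟨hm, r, hr, hsupp, har, -⟩ := ha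
  have h := setLIntegral_closedBall_le_of_eLpNorm_le hp hm hr har hr
  rw [div_self hr.ne', Real.one_rpow, ENNReal.ofReal_one] at h
  rwa [setLIntegral_eq_of_support_subset ?_] at h
  intro x hx
  exact hsupp (by simpa using hx)

lemma IsCentralAtom.integrable {p : ℝ} (hp : 1 < p) {a : Rn n → ℂ}
    (ha : IsCentralAtom p a) : Integrable a volume :=
  ⟨ha.1, (ha.lintegral_enorm_le hp).trans_lt ENNReal.one_lt_top⟩

lemma IsCentralAtom.integral_norm_le {p : ℝ} (hp : 1 < p) {a : Rn n → ℂ}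
    (ha : IsCentralAtom p a) : ∫ x, ‖a x‖ ≤ 1 := by
  rw [integral_norm_eq_lintegral_enorm ha.1]
  exact ENNReal.toReal_le_of_le_ofReal zero_le_one (by simpa using ha.lintegral_enorm_le hp)

lemma IsCentralAtom.exists_enorm_setIntegral_ball_le {p : ℝ} (hp : 1 < p) {a : Rn n → ℂ}
    (ha : IsCentralAtom p a) : ∃ r : ℝ, 0 < r ∧ ∀ k, ∀ x ∈ annulus n k,
      ‖∫ y in ball (0 : Rn n) ‖x‖, a y‖ₑ ≤ atomMajorant ((n : ℝ) / Real.conjExponent p) r k := by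
  obtain ⟨hm, r, hr, hsupp, har, hzero⟩ := ha
  refine ⟨r, hr, fun k x hx => ?_⟩
  have hx' := mem_annulus.1 hx
  rw [atomMajorant]
  split_ifs with h
  · refine (enorm_integral_le_lintegral_enorm _).trans ?_
    refine (lintegral_mono_set (ball_subset_closedBall.trans
      (closedBall_subset_closedBall hx'.2))).trans ?_
    exact setLIntegral_closedBall_le_of_eLpNorm_le hp hm hr har (by positivity)
  -- Here `r ≤ 2 ^ (k - 1) < ‖x‖`, so the open ball contains the whole support.
  · rw [setIntegral_eq_integral_of_forall_compl_eq_zero, hzero, enorm_zero]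
    intro y hy
    by_contra hay
    have h1 := hsupp (Function.mem_support.2 hay)
    simp only [mem_closedBall, dist_zero_right, mem_ball, not_lt] at h1 hy
    linarith

/-- Atoms have `L¹` norm at most `1`, so the series converges absolutely in `L¹` and may be
integrated termwise. -/
lemma hasSum_setIntegral_of_isAtomicDecomposition {p : ℝ} (hp : 1 < p) {f : Rn n → ℂ} {c : ℕ → ℂ}
    {a : ℕ → Rn n → ℂ} (h : IsAtomicDecomposition p f c a) (s : Set (Rn n)) :
    HasSum (fun j => c j * ∫ y in s, a j y) (∫ y in s, f y) := by
  obtain ⟨ha, hc, hf⟩ := h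
  have hint : ∀ j, Integrable (fun y => c j * a j y) (volume.restrict s) :=
    fun j => (((ha j).integrable hp).const_mul (c j)).restrict
  have hsum : Summable fun j => ∫ y in s, ‖c j * a j y‖ := by
    refine hc.of_nonneg_of_le (fun j => integral_nonneg fun y => norm_nonneg _) fun j => ?_
    simp_rw [norm_mul]
    rw [integral_const_mul]
    refine mul_le_of_le_one_right (norm_nonneg _) (le_trans ?_ ((ha j).integral_norm_le hp))
    exact setIntegral_le_integral ((ha j).integrable hp).norm
      (Eventually.of_forall fun y => norm_nonneg _)
  have key := hasSum_integral_of_summable_integral_norm hint hsum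
  simp_rw [integral_const_mul] at key
  rwa [integral_congr_ae (ae_restrict_of_ae (hf.mono fun x hx => hx.tsum_eq))] at key

lemma exists_herzENorm_hardyOp_le_of_isAtomicDecomposition (hn : 1 ≤ n) {p : ℝ} (hp : 1 < p) :
    ∃ C : ℝ≥0, ∀ (f : Rn n → ℂ) (c : ℕ → ℂ) (a : ℕ → Rn n → ℂ), IsAtomicDecomposition p f c a →
      herzENorm p (hardyOp f) ≤ C * ∑' j, ‖c j‖ₑ := by
  have hq := conjExponent_pos hp
  have hn' : (0 : ℝ) < n := by exact_mod_cast hn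
  obtain ⟨C, hC⟩ := exists_tsum_atomMajorant_le (div_pos hn' hq)
  refine ⟨(2 ^ n * volume.real (ball (0 : Rn n) 1) ^ (1 / p - 1)).toNNReal * C,
    fun f c a h => ?_⟩
  choose r hr hra using fun j => (h.1 j).exists_enorm_setIntegral_ball_le hp
  have hbound : ∀ k, ∀ x ∈ annulus n k, ‖∫ y in ball (0 : Rn n) ‖x‖, f y‖ₑ ≤
      ∑' j, ‖c j‖ₑ * atomMajorant ((n : ℝ) / Real.conjExponent p) (r j) k := by
    intro k x hx
    rw [← (hasSum_setIntegral_of_isAtomicDecomposition hp h _).tsum_eq]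
    refine enorm_tsum_le_tsum_enorm.trans (ENNReal.tsum_le_tsum fun j => ?_)
    rw [enorm_mul]
    gcongr
    exact hra j k x hx
  refine (herzENorm_hardyOp_le hp hbound).trans ?_
  -- Summing over `k` first lets the bound uniform in `r j` apply to each atom.
  rw [ENNReal.coe_mul, mul_assoc, ENNReal.tsum_comm]
  refine mul_le_mul_right ?_ _
  rw [← ENNReal.tsum_mul_left]
  refine ENNReal.tsum_le_tsum fun j => ?_
  rw [ENNReal.tsum_mul_left, mul_comm]
  gcongr
  exact hC (r j) (hr j)

lemma IsAtomicDecomposition.tsum_enorm_lt_top {p : ℝ} {f : Rn n → ℂ} {c : ℕ → ℂ}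
    {a : ℕ → Rn n → ℂ} (h : IsAtomicDecomposition p f c a) : ∑' j, ‖c j‖ₑ < ∞ := by
  have := h.2.1.tsum_ofReal_lt_top
  simpa only [ofReal_norm] using this

lemma le_mul_atomicENorm {p : ℝ} {f : Rn n → ℂ} {X : ℝ≥0∞} {C : ℝ≥0} (hf : MemAtomic p f)
    (h : ∀ c a, IsAtomicDecomposition p f c a → X ≤ C * ∑' j, ‖c j‖ₑ) :
    X ≤ C * atomicENorm p f := by
  obtain ⟨-, c₀, a₀, h₀⟩ := hf
  -- Division by `C` fails at `C = 0`; there one existing decomposition already forces `X = 0`.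
  rcases eq_or_ne C 0 with rfl | hC
  · simpa using h c₀ a₀ h₀
  · have hC' : (C : ℝ≥0∞) ≠ 0 := by simpa using hC
    rw [mul_comm, ← ENNReal.div_le_iff hC' ENNReal.coe_ne_top]
    refine le_iInf fun c => le_iInf fun a => le_iInf fun hca => ?_
    rw [ENNReal.div_le_iff hC' ENNReal.coe_ne_top, mul_comm]
    exact h c a hca

end HerzHardy

theorem theorem2p5 (n : ℕ) (hn : 1 ≤ n) (p : ℝ) (hp : 1 < p) :
    (∀ N : ℕ, n + 1 < N → ∃ C : ℝ≥0, ∀ f : HerzHardy.Rn n → ℂ,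
      HerzHardy.MemHardyHerz N p f →
        HerzHardy.MemHerz p (HerzHardy.hardyOp f) ∧
        HerzHardy.herzENorm p (HerzHardy.hardyOp f) ≤ C * HerzHardy.hardyHerzENorm N p f) ∧
    (∃ C : ℝ≥0, ∀ f : HerzHardy.Rn n → ℂ,
      HerzHardy.MemAtomic p f →
        HerzHardy.MemHerz p (HerzHardy.hardyOp f) ∧
        HerzHardy.herzENorm p (HerzHardy.hardyOp f) ≤ C * HerzHardy.atomicENorm p f) := by
  refine ⟨fun N _ => ?_, ?_⟩
  · obtain ⟨C, hC⟩ := HerzHardy.exists_herzENorm_hardyOp_le_hardyHerzENorm hn hp N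
    refine ⟨C, fun f hf => ⟨⟨HerzHardy.aestronglyMeasurable_hardyOp hf.1, ?_⟩, hC f hf.1⟩⟩
    exact (hC f hf.1).trans_lt (ENNReal.mul_lt_top ENNReal.coe_lt_top hf.2)
  · obtain ⟨C, hC⟩ := HerzHardy.exists_herzENorm_hardyOp_le_of_isAtomicDecomposition hn hp
    refine ⟨C, fun f hf => ⟨⟨HerzHardy.aestronglyMeasurable_hardyOp hf.1, ?_⟩,
      HerzHardy.le_mul_atomicENorm hf (hC f)⟩⟩
    obtain ⟨-, c, a, h⟩ := hf
    exact (hC f c a h).trans_lt (ENNReal.mul_lt_top ENNReal.coe_lt_top h.tsum_enorm_lt_top)
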